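/- Let $\Omega\subset\mathbb R^3$ be a bounded Lipschitz domain and let $B\subset\Omega$ be a Lipschitz domain. Let $j_c>0$, let $\boldsymbol E_d\in C^1(B;\mathbb R^3)$ and $\kappa\in C^1(B)$ with $\kappa>0$ in $B$, let $\boldsymbol f\in L^2(\Omega;\mathbb R^3)\cap C^1(B;\mathbb R^3)$, and let $\epsilon,\nu\in L^\infty(\Omega;\mathbb R^{3\times3})\cap C^1(B;\mathbb R^{3\times3})$ be symmetric and uniformly positive definite, i.e. there are $\underline\nu,\underline\epsilon>0$ with $\xi^{\mathsf T}\nu(x)\xi\ge\underline\nu|\xi|^2$ and $\xi^{\mathsf T}\epsilon(x)\xi\ge\underline\epsilon|\xi|^2$ for a.e. $x\in\Omega$ and all $\xi\in\mathbb R^3$. Here $C^1(B)$ is the space of continuously differentiable functions on $B$ that are bounded together with their first derivatives. Let $\boldsymbol H_0(\mathbf{curl})$ be the closure of $C_0^\infty(\Omega;\mathbb R^3)$ in $\boldsymbol H(\mathbf{curl})=\{\boldsymbol v\in L^2(\Omega;\mathbb R^3):\mathbf{curl}\,\boldsymbol v\in L^2(\Omega;\mathbb R^3)\}$ with its graph norm,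 and put $$a(\boldsymbol v,\boldsymbol w)=\int_\Omega\nu\,\mathbf{curl}\,\boldsymbol v\cdot\mathbf{curl}\,\boldsymbol w\,dx+\int_\Omega\epsilon\,\boldsymbol v\cdot\boldsymbol w\,dx .$$ Fix $L\ge0$ and $r>0$, and let $\mathcal O$ be the set of all open sets $\omega\subset B$ that are uniformly Lipschitz with constant $L$: for every $x_0\in\partial\omega$ there are Cartesian coordinates $(y_1,y_2,y_3)$ centred at $x_0$ and an $L$-Lipschitz function $\varphi:\mathbb R^2\to\mathbb R$ such that, in the open ball of radius $r$ about $x_0$, $\omega$ consists exactly of the points with $y_3>\varphi(y_1,y_2)$. Let $\gamma>0$ be fixed and let $$\max\nolimits_\gamma\{1,s\}=\begin{cases}s,& s-1\ge\frac1{2\gamma},\\ 1+\frac\gamma2\left(s-1+\frac1{2\gamma}\right)^2,&|s-1|\le\frac1{2\gamma},\\ 1,& s-1\le-\frac1{2\gamma}.\end{cases}$$ Then for every $\omega\in\mathcal O$ there is a unique $\boldsymbol E^\gamma(\omega)=\boldsymbol E^\gamma\in\boldsymbol H_0(\mathbf{curl})$ such that $$a(\boldsymbol E^\gamma,\boldsymbol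 v)+\int_\omega\frac{j_c\gamma\,\boldsymbol E^\gamma}{\max_\gamma\{1,\gamma|\boldsymbol E^\gamma|\}}\cdot\boldsymbol v\,dx=\int_\Omega\boldsymbol f\cdot\boldsymbol v\,dx\qquad\text{for all }\boldsymbol v\in\boldsymbol H_0(\mathbf{curl}),$$ and the penalized shape optimization problem $$\min_{\omega\in\mathcal O}J_\gamma(\omega),\qquad J_\gamma(\omega)=\frac12\int_B\kappa\,|\boldsymbol E^\gamma(\omega)-\boldsymbol E_d|^2\,dx+\int_\omega dx,$$ has an optimal shape: there is $\omega_\star^\gamma\in\mathcal O$ with $J_\gamma(\omega_\star^\gamma)\le J_\gamma(\omega)$ for all $\omega\in\mathcal O$. -/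

import Mathlib

open MeasureTheory Set
open scoped NNReal ENNReal Matrix

noncomputable section

/-- Three-dimensional Euclidean space. -/
abbrev E3 : Type := EuclideanSpace ℝ (Fin 3)

/-! ### Lipschitz sets -/

/-- Near the point `x₀`, the set `U` is the strict epigraph of an `L`-Lipschitz function of two
variables: in a Cartesian coordinate system `R` centred at `x₀`, the part of `U` in the open ball of
radius `r` about `x₀` consists of the points of that ball with `y₃ > φ (y₁, y₂)`. -/
def IsLipschitzEpigraphNear (U : Set E3) (L : ℝ≥0) (r : ℝ) (x₀ : E3) : Prop :=
  ∃ (R : E3 ≃ₗᵢ[ℝ] E3) (φ : EuclideanSpace ℝ (Fin 2) → ℝ), LipschitzWith L φ ∧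
    ∀ x ∈ Metric.ball x₀ r,
      (x ∈ U ↔ φ !₂[R (x - x₀) 0, R (x - x₀) 1] < R (x - x₀) 2)

/-- A Lipschitz domain: a nonempty connected open set whose boundary is locally a Lipschitz graph,
with the set on one side of it. -/
def IsLipschitzDomain (U : Set E3) : Prop :=
  IsOpen U ∧ IsConnected U ∧
    ∀ x₀ ∈ frontier U, ∃ (L : ℝ≥0) (r : ℝ), 0 < r ∧ IsLipschitzEpigraphNear U L r x₀

/-- A uniformly Lipschitz set: one Lipschitz constant `L` and one size `r` of the neighbourhoods
serve all boundary points. -/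
def IsUniformlyLipschitz (L : ℝ≥0) (r : ℝ) (U : Set E3) : Prop :=
  ∀ x₀ ∈ frontier U, IsLipschitzEpigraphNear U L r x₀

/-! ### Functions of class `C¹` with finite `C¹` norm -/

/-- `u ∈ C¹(B)` for an open set `B`: `u` is continuously differentiable in `B`, and `u` and its
derivative are bounded in `B`. -/
def IsC1 {F : Type*} [NormedAddCommGroup F] [NormedSpace ℝ F] (B : Set E3) (u : E3 → F) : Prop :=
  ContDiffOn ℝ 1 u B ∧ ∃ C : ℝ, ∀ x ∈ B, ‖u x‖ ≤ C ∧ ‖fderiv ℝ u x‖ ≤ C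

/-! ### The spaces `H(curl)` and `H₀(curl)` -/

/-- The partial derivative `∂ᵢ φⱼ`. -/
def partialD (φ : E3 → E3) (i j : Fin 3) (x : E3) : ℝ :=
  (fderiv ℝ φ x (EuclideanSpace.single i 1)) j

/-- The classical curl of a differentiable vector field. -/
def curl (φ : E3 → E3) (x : E3) : E3 :=
  !₂[partialD φ 1 2 x - partialD φ 2 1 x,
     partialD φ 2 0 x - partialD φ 0 2 x,
     partialD φ 0 1 x - partialD φ 1 0 x]

/-- The test fields: smooth vector fields with compact support in `Ω`. -/
def IsTestField (Ω : Set E3) (φ : E3 → E3) : Prop :=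
  ContDiff ℝ (⊤ : ℕ∞) φ ∧ HasCompactSupport φ ∧ tsupport φ ⊆ Ω

/-- The Hilbert space of square integrable vector fields on `Ω`. -/
abbrev L2Field (Ω : Set E3) : Type := Lp E3 2 (volume.restrict Ω)

/-- Pairs of square integrable vector fields with the norm `(‖v‖² + ‖c‖²) ^ (1/2)`. -/
abbrev L2Pair (Ω : Set E3) : Type := WithLp 2 (L2Field Ω × L2Field Ω)

/-- `c` is the curl of `v` in the sense of distributions on `Ω`. -/
def IsWeakCurl (Ω : Set E3) (v c : L2Field Ω) : Prop :=
  ∀ φ : E3 → E3, IsTestField Ω φ →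
    ∫ x in Ω, inner ℝ (c x) (φ x) = ∫ x in Ω, inner ℝ (v x) (curl φ x)

theorem continuous_partialD {φ : E3 → E3} (h : ContDiff ℝ (⊤ : ℕ∞) φ) (i j : Fin 3) :
    Continuous (partialD φ i j) := by
  have h1 : Continuous (fderiv ℝ φ) := h.continuous_fderiv (by simp)
  have h2 : Continuous fun x => fderiv ℝ φ x (EuclideanSpace.single i (1 : ℝ)) :=
    h1.clm_apply continuous_const
  exact (EuclideanSpace.proj (𝕜 := ℝ) j).continuous.comp h2

theorem IsTestField.memLp {Ω : Set E3} {φ : E3 → E3} (h : IsTestField Ω φ) :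
    MemLp φ 2 (volume.restrict Ω) :=
  h.1.continuous.memLp_of_hasCompactSupport h.2.1

theorem IsTestField.memLp_curl {Ω : Set E3} {φ : E3 → E3} (h : IsTestField Ω φ) :
    MemLp (curl φ) 2 (volume.restrict Ω) := by
  have hc : Continuous (curl φ) := by
    refine (PiLp.continuous_toLp 2 _).comp (continuous_pi fun k => ?_)
    fin_cases k <;>
      exact (continuous_partialD h.1 _ _).sub (continuous_partialD h.1 _ _)
  refine hc.memLp_of_hasCompactSupport ?_
  refine (h.2.1.fderiv (𝕜 := ℝ)).mono' fun x hx => ?_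
  by_contra hx'
  have h0 : fderiv ℝ φ x = 0 := by
    by_contra h1
    exact hx' (subset_tsupport _ h1)
  apply hx
  ext k
  fin_cases k <;> simp [curl, partialD, h0]

theorem integral_inner_add_L2 {Ω : Set E3} (u v : L2Field Ω) {g : E3 → E3}
    (hg : MemLp g 2 (volume.restrict Ω)) :
    ∫ x in Ω, inner ℝ ((u + v : L2Field Ω) x) (g x)
      = (∫ x in Ω, inner ℝ (u x) (g x)) + ∫ x in Ω, inner ℝ (v x) (g x) := by
  have key : ∀ w : L2Field Ω, Integrable (fun x => inner ℝ (w x) (g x)) (volume.restrict Ω) := by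
    intro w
    refine (L2.integrable_inner (𝕜 := ℝ) w (hg.toLp g)).congr ?_
    filter_upwards [hg.coeFn_toLp] with x hx
    rw [hx]
  rw [← integral_add (key u) (key v)]
  refine integral_congr_ae ?_
  filter_upwards [Lp.coeFn_add u v] with x hx
  rw [hx, Pi.add_apply, inner_add_left]

theorem integral_inner_smul_L2 {Ω : Set E3} (t : ℝ) (v : L2Field Ω) (g : E3 → E3) :
    ∫ x in Ω, inner ℝ ((t • v : L2Field Ω) x) (g x) = t * ∫ x in Ω, inner ℝ (v x) (g x) := by
  rw [← integral_const_mul]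
  refine integral_congr_ae ?_
  filter_upwards [Lp.coeFn_smul t v] with x hx
  rw [hx, Pi.smul_apply, real_inner_smul_left]

/-- The space `H(curl)`, each field `v` being stored together with its distributional curl as the
pair `(v, curl v)`, so that the norm of the pair is the norm of `H(curl)`. -/
def Hcurl (Ω : Set E3) : Submodule ℝ (L2Pair Ω) where
  carrier := {p | IsWeakCurl Ω p.fst p.snd}
  add_mem' := by
    intro p q hp hq φ hφ
    rw [WithLp.add_fst, WithLp.add_snd, integral_inner_add_L2 _ _ hφ.memLp,
      integral_inner_add_L2 _ _ hφ.memLp_curl, hp φ hφ, hq φ hφ]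
  zero_mem' := by
    intro φ hφ
    have h := integral_inner_smul_L2 (Ω := Ω) 0 0
    simp only [zero_smul, zero_mul] at h
    rw [WithLp.zero_fst, WithLp.zero_snd, h, h]
  smul_mem' := by
    intro t p hp φ hφ
    rw [WithLp.smul_fst, WithLp.smul_snd, integral_inner_smul_L2, integral_inner_smul_L2, hp φ hφ]

/-- The pairs `(φ, curl φ)` of the test fields `φ`. -/
def testPairs (Ω : Set E3) : Set (L2Pair Ω) :=
  {p | ∃ φ : E3 → E3, IsTestField Ω φ ∧
    p.fst =ᵐ[volume.restrict Ω] φ ∧ p.snd =ᵐ[volume.restrict Ω] curl φ}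

/-- The space `H₀(curl)`: the closure of the test fields with respect to the norm of `H(curl)`.
(The pairs `testPairs Ω` already form a linear space.) -/
def H0curl (Ω : Set E3) : Submodule ℝ (L2Pair Ω) :=
  Hcurl Ω ⊓ (Submodule.span ℝ (testPairs Ω)).topologicalClosure

/-- The vector field underlying an element of `H₀(curl)`. -/
def field {Ω : Set E3} (v : H0curl Ω) : E3 → E3 := v.1.fst

/-- The curl of an element of `H₀(curl)`. -/
def rot {Ω : Set E3} (v : H0curl Ω) : E3 → E3 := v.1.snd

/-! ### The penalized dual variable -/

/-- The regularized maximum `max_γ {1, s}`. -/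
def maxReg (γ s : ℝ) : ℝ :=
  if 1 / (2 * γ) ≤ s - 1 then s
  else if |s - 1| ≤ 1 / (2 * γ) then 1 + γ / 2 * (s - 1 + 1 / (2 * γ)) ^ 2
  else 1

/-- The vector `j γ e / max_γ {1, γ |e|}`. -/
def dualMap (j γ : ℝ) (e : E3) : E3 :=
  (j * γ / maxReg γ (γ * ‖e‖)) • e

/-! ### The shape optimization problem -/

/-- The data of the problem: the domain `Ω`, the region `B` for the superconductor, the critical
current density `jc`, the weight `κ`, the target field `Ed`, the magnetic reluctivity `ν`, the
electric permittivity `ε`, and the applied current source `f`. -/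
structure HTSData where
  Ω : Set E3
  B : Set E3
  jc : ℝ
  κ : E3 → ℝ
  Ed : E3 → E3
  ν : E3 → Matrix (Fin 3) (Fin 3) ℝ
  ε : E3 → Matrix (Fin 3) (Fin 3) ℝ
  f : E3 → E3

/-- A material parameter: a matrix function in `L^∞(Ω) ∩ C¹(B)` that is symmetric and uniformly
positive definite a.e. in `Ω`. -/
structure IsMaterialParameter (Ω B : Set E3) (A : E3 → Matrix (Fin 3) (Fin 3) ℝ) : Prop where
  memLp_top : ∀ i j, MemLp (fun x => A x i j) ∞ (volume.restrict Ω)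
  isC1 : ∀ i j, IsC1 B fun x => A x i j
  symm : ∀ᵐ x ∂volume.restrict Ω, (A x).IsSymm
  posDef : ∃ a : ℝ, 0 < a ∧
    ∀ᵐ x ∂volume.restrict Ω, ∀ ξ : E3, a * ‖ξ‖ ^ 2 ≤ ξ.ofLp ⬝ᵥ (A x *ᵥ ξ.ofLp)

namespace HTSData

/-- The standing assumptions on the data. -/
structure Admissible (D : HTSData) : Prop where
  bounded : Bornology.IsBounded D.Ω
  lipschitz : IsLipschitzDomain D.Ω
  subset : D.B ⊆ D.Ω
  lipschitz_B : IsLipschitzDomain D.B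
  isC1_Ed : IsC1 D.B D.Ed
  isC1_κ : IsC1 D.B D.κ
  κ_pos : ∀ x ∈ D.B, 0 < D.κ x
  jc_pos : 0 < D.jc
  material_ν : IsMaterialParameter D.Ω D.B D.ν
  material_ε : IsMaterialParameter D.Ω D.B D.ε
  memLp_f : MemLp D.f 2 (volume.restrict D.Ω)
  isC1_f : IsC1 D.B D.f

/-- The admissible shapes: the open subsets of `B` that are Lipschitz, uniformly with constant `L`
(in neighbourhoods of size `r`). -/
def shapes (D : HTSData) (L : ℝ≥0) (r : ℝ) : Set (Set E3) :=
  {ω | ω ⊆ D.B ∧ IsOpen ω ∧ IsUniformlyLipschitz L r ω}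

/-- The bilinear form `a(v, w) = ∫_Ω ν curl v · curl w + ∫_Ω ε v · w`. -/
def bilin (D : HTSData) (v w : H0curl D.Ω) : ℝ :=
  (∫ x in D.Ω, (D.ν x *ᵥ (rot v x).ofLp) ⬝ᵥ (rot w x).ofLp)
    + ∫ x in D.Ω, (D.ε x *ᵥ (field v x).ofLp) ⬝ᵥ (field w x).ofLp

/-- `E` solves the penalized state equation for the shape `ω`:
`a(E, v) + ∫_ω λ · v = ∫_Ω f · v` for all `v` in `H₀(curl)`, where
`λ = jc γ E / max_γ {1, γ |E|}` in `ω`. -/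
def IsState (D : HTSData) (γ : ℝ) (ω : Set E3) (E : H0curl D.Ω) : Prop :=
  ∀ v : H0curl D.Ω,
    D.bilin E v + ∫ x in ω, inner ℝ (dualMap D.jc γ (field E x)) (field v x)
      = ∫ x in D.Ω, inner ℝ (D.f x) (field v x)

/-- The electric field `E^γ(ω)`: the solution of the penalized state equation. -/
def state (D : HTSData) (γ : ℝ) (ω : Set E3) : H0curl D.Ω :=
  Classical.epsilon (D.IsState γ ω)

/-- The cost `J_γ(ω) = ½ ∫_B κ |E^γ(ω) - Ed|² + ∫_ω 1`. -/
def cost (D : HTSData) (γ : ℝ) (ω : Set E3) : ℝ :=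
  1 / 2 * (∫ x in D.B, D.κ x * ‖field (D.state γ ω) x - D.Ed x‖ ^ 2) + ∫ _x in ω, (1 : ℝ)

end HTSData

end

/-! For a fixed shape the penalized equation is governed by a Lipschitz, strongly monotone operator
on `H0curl`: the bilinear form is coercive and the nonlinear term is monotone, because `dualMap` is
radial with nondecreasing radial part. A contraction argument gives the unique state
(`existsUnique_of_stronglyMonotone`). The monotonicity constant does not depend on the shape, and
the dual variable is bounded by `jc`; hence the state, and with it the cost, depends continuously on
the shape when shapes are compared by the volume of their symmetric difference (`tendsto_state`,
`tendsto_cost`). Convergence of the states is strong, so the nonlinearity needs no compact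
embedding.

The optimal shape comes from the direct method, and what remains is compactness of the uniformly
Lipschitz shapes. It is obtained along an ultrafilter. The limit shape consists of the points with a
fixed ball inside almost all shapes; the complements have a limit in the same sense. Near any point
in neither limit, the Lipschitz charts of the shapes converge to one Lipschitz chart that separates
the two limits (`exists_graph_near_limit`). So the limit shape is again uniformly Lipschitz with the
same `L` and `r`, the points in neither limit form a null set, and the shapes converge in volume. -/

/-! ### Compactness of uniformly Lipschitz shapes. -/

noncomputable section

open Filter Topology Metric
open scoped Pointwise

/-! ### Limits along ultrafilters -/

/-- Closed balls are compact, so bounded families converge along every ultrafilter. One ultrafilter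
serves all points at once, which replaces the extraction of subsequences. -/
theorem Ultrafilter.exists_tendsto_of_dist_le {ι X : Type*} [PseudoMetricSpace X] [ProperSpace X]
    (𝒰 : Ultrafilter ι) {f : ι → X} {x : X} {C : ℝ} (h : ∀ n, dist (f n) x ≤ C) :
    ∃ y, Tendsto f 𝒰 (𝓝 y) := by
  obtain ⟨y, -, hy⟩ := (isCompact_closedBall x C).ultrafilter_le_nhds (𝒰.map f) (by
    rw [Ultrafilter.coe_map, le_principal_iff]
    exact Filter.mem_map.2 (univ_mem' h))
  exact ⟨y, hy⟩

/-- Linearity and norm preservation pass to the pointwise limit; a linear isometry of a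
finite-dimensional space into itself is onto. -/
theorem exists_tendsto_linearIsometryEquiv {ι E : Type*} [NormedAddCommGroup E]
    [NormedSpace ℝ E] [FiniteDimensional ℝ E] (𝒰 : Ultrafilter ι) (R : ι → E ≃ₗᵢ[ℝ] E) :
    ∃ S : E ≃ₗᵢ[ℝ] E, ∀ y, Tendsto (fun n => R n y) 𝒰 (𝓝 (S y)) := by
  have : ProperSpace E := FiniteDimensional.proper ℝ E
  have h : ∀ y, ∃ z, Tendsto (fun n => R n y) 𝒰 (𝓝 z) := fun y =>
    𝒰.exists_tendsto_of_dist_le (x := 0) (C := ‖y‖) fun n => by simp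
  choose S hS using h
  let T : E →ₗᵢ[ℝ] E :=
    { toFun := S
      map_add' := fun x y => tendsto_nhds_unique (hS (x + y)) (by
        simpa using (hS x).add (hS y))
      map_smul' := fun c x => tendsto_nhds_unique (hS (c • x)) (by
        simpa using (hS x).const_smul c)
      norm_map' := fun x => tendsto_nhds_unique (hS x).norm (by simp) }
  exact ⟨T.toLinearIsometryEquiv rfl, hS⟩

/-- Plays the role of Arzelà–Ascoli. The common zero at `x₀` and the common Lipschitz constant bound
the values at each point. -/
theorem exists_tendsto_lipschitzWith {ι X : Type*} [PseudoMetricSpace X] (𝒰 : Ultrafilter ι)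
    {L : ℝ≥0} {φ : ι → X → ℝ} (hφ : ∀ n, LipschitzWith L (φ n)) {x₀ : X}
    (h0 : ∀ n, φ n x₀ = 0) :
    ∃ ψ : X → ℝ, LipschitzWith L ψ ∧ ∀ y, Tendsto (fun n => φ n y) 𝒰 (𝓝 (ψ y)) := by
  have h : ∀ y, ∃ z, Tendsto (fun n => φ n y) 𝒰 (𝓝 z) := fun y =>
    𝒰.exists_tendsto_of_dist_le (x := 0) (C := L * dist y x₀) fun n => by
      simpa [h0] using (hφ n).dist_le_mul y x₀
  choose ψ hψ using h
  refine ⟨ψ, LipschitzWith.of_dist_le_mul fun x y => ?_, hψ⟩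
  exact le_of_tendsto ((hψ x).dist (hψ y)) (Eventually.of_forall fun n => (hφ n).dist_le_mul x y)

/-! ### The limit of a family of sets along an ultrafilter -/

/-- The points having a ball that is contained in the sets `ω n` for almost all `n`. -/
def limitShape {ι X : Type*} [PseudoMetricSpace X] (𝒰 : Ultrafilter ι) (ω : ι → Set X) : Set X :=
  {x | ∃ δ > 0, ∀ᶠ n in (𝒰 : Filter ι), ball x δ ⊆ ω n}

section limitShape

variable {ι X : Type*} [PseudoMetricSpace X] {𝒰 : Ultrafilter ι} {ω : ι → Set X}

theorem isOpen_limitShape : IsOpen (limitShape 𝒰 ω) := by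
  rw [Metric.isOpen_iff]
  rintro x ⟨δ, hδ, h⟩
  refine ⟨δ / 2, half_pos hδ, fun y hy => ⟨δ / 2, half_pos hδ, ?_⟩⟩
  filter_upwards [h] with n hn
  refine (ball_subset_ball' ?_).trans hn
  rw [mem_ball] at hy
  linarith

theorem limitShape_subset {B : Set X} (h : ∀ n, ω n ⊆ B) : limitShape 𝒰 ω ⊆ B := by
  rintro x ⟨δ, hδ, hx⟩
  obtain ⟨n, hn⟩ := hx.exists
  exact h n (hn (mem_ball_self hδ))

theorem disjoint_limitShape_compl :
    Disjoint (limitShape 𝒰 ω) (limitShape 𝒰 fun n => (ω n)ᶜ) := by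
  rw [Set.disjoint_left]
  rintro x ⟨δ, hδ, hx⟩ ⟨δ', hδ', hx'⟩
  obtain ⟨n, hn, hn'⟩ := (hx.and hx').exists
  exact hn' (mem_ball_self hδ') (hn (mem_ball_self hδ))

theorem IsCompact.eventually_subset_of_subset_limitShape {K : Set X} (hK : IsCompact K)
    (h : K ⊆ limitShape 𝒰 ω) : ∀ᶠ n in (𝒰 : Filter ι), K ⊆ ω n := by
  have h'' : ∀ x, ∃ δ, x ∈ K → 0 < δ ∧ ∀ᶠ n in (𝒰 : Filter ι), ball x δ ⊆ ω n := fun x => by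
    by_cases hx : x ∈ K
    · obtain ⟨δ, hδ, h1⟩ := h hx
      exact ⟨δ, fun _ => ⟨hδ, h1⟩⟩
    · exact ⟨0, fun h => absurd h hx⟩
  choose δ hδ using h''
  obtain ⟨t, ht, hKt⟩ := hK.elim_nhds_subcover (fun x => ball x (δ x)) fun x hx =>
    ball_mem_nhds x (hδ x hx).1
  have : ∀ᶠ n in (𝒰 : Filter ι), ∀ x ∈ t, ball x (δ x) ⊆ ω n :=
    (Filter.eventually_all_finset t).2 fun x hx => (hδ x (ht x hx)).2
  filter_upwards [this] with n hn
  exact hKt.trans (iUnion₂_subset hn)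

/-- Positivity of the limit `G y` gives `F n y > G y / 2` for almost all `n`, and the common
Lipschitz constant spreads positivity to a ball whose radius does not depend on `n`, as membership
in `limitShape` demands. -/
theorem mem_limitShape_of_tendsto {x : ι → X} {x₀ : X} (hx : Tendsto x 𝒰 (𝓝 x₀)) {r : ℝ}
    {K : ℝ≥0} {F : ι → X → ℝ} (hF : ∀ n, LipschitzWith K (F n)) {G : X → ℝ}
    (hG : ∀ y, Tendsto (fun n => F n y) 𝒰 (𝓝 (G y)))
    (h : ∀ᶠ n in (𝒰 : Filter ι), ∀ y ∈ ball (x n) r, 0 < F n y → y ∈ ω n)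
    {y : X} (hy : y ∈ ball x₀ r) (hGy : 0 < G y) : y ∈ limitShape 𝒰 ω := by
  rw [mem_ball] at hy
  obtain ⟨η, hη, hηG⟩ : ∃ η > 0, K * η < G y / 2 := by
    refine ⟨G y / 2 / (K + 1), by positivity, ?_⟩
    rw [mul_div_assoc', div_lt_iff₀ (by positivity)]
    nlinarith [K.2]
  -- Half of the slack `r - dist y x₀` pays for the radius of the ball around `y`, the other half
  -- for the distance from `x n` to `x₀`; `η` limits the loss in `F n`.
  set δ := min ((r - dist y x₀) / 2) η
  have hδ : 0 < δ := lt_min (by linarith) hη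
  have hδ1 : δ ≤ (r - dist y x₀) / 2 := min_le_left _ _
  have hδ2 : δ ≤ η := min_le_right _ _
  refine ⟨δ, hδ, ?_⟩
  have h2 : G y / 2 < G y := by linarith
  filter_upwards [h, (hG y).eventually (lt_mem_nhds h2), Metric.tendsto_nhds.1 hx δ hδ]
    with n hn hn1 hn2 z hz
  rw [mem_ball] at hz
  refine hn z ?_ ?_
  · rw [mem_ball]
    have := dist_triangle4 z y x₀ (x n)
    rw [dist_comm x₀] at this
    linarith
  · have h3 := (hF n).dist_le_mul y z
    rw [Real.dist_eq, dist_comm] at h3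
    have h4 : (K : ℝ) * dist z y ≤ K * η :=
      mul_le_mul_of_nonneg_left (hz.le.trans hδ2) K.2
    have := le_abs_self (F n y - F n z)
    linarith

/-- For an ultrafilter, failing to hold for almost all `n` means being false for almost all `n`. So
almost every `ω n` meets the ball without containing it, and a connected ball must then meet the
frontier. -/
theorem eventually_nonempty_ball_inter_frontier {E : Type*} [NormedAddCommGroup E]
    [NormedSpace ℝ E] {ω : ι → Set E} {x : E} (h1 : x ∉ limitShape 𝒰 ω)
    (h2 : x ∉ limitShape 𝒰 fun n => (ω n)ᶜ) {δ : ℝ} (hδ : 0 < δ) :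
    ∀ᶠ n in (𝒰 : Filter ι), (ball x δ ∩ frontier (ω n)).Nonempty := by
  have h1' : ∀ᶠ n in (𝒰 : Filter ι), ¬ ball x δ ⊆ ω n :=
    Ultrafilter.eventually_not.2 fun h => h1 ⟨δ, hδ, h⟩
  have h2' : ∀ᶠ n in (𝒰 : Filter ι), ¬ ball x δ ⊆ (ω n)ᶜ :=
    Ultrafilter.eventually_not.2 fun h => h2 ⟨δ, hδ, h⟩
  filter_upwards [h1', h2'] with n hn1 hn2
  have hconn : IsPreconnected (ball x δ) := (convex_ball x δ).isPreconnected
  rw [Set.not_subset] at hn1 hn2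
  obtain ⟨y, hy, hyω⟩ := hn1
  obtain ⟨z, hz, hzω⟩ := hn2
  by_contra hempty
  have hcov : ball x δ ⊆ interior (ω n) ∪ interior (ω n)ᶜ := by
    intro w hw
    by_contra hw'
    rw [mem_union, not_or, interior_compl, mem_compl_iff, not_not] at hw'
    exact hempty ⟨w, hw, hw'.2, hw'.1⟩
  obtain ⟨w, -, hw1, hw2⟩ := hconn _ _ isOpen_interior isOpen_interior hcov
    ⟨z, hz, (hcov hz).resolve_right fun h => hzω (interior_subset h)⟩
    ⟨y, hy, (hcov hy).resolve_left fun h => hyω (interior_subset h)⟩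
  exact interior_subset hw2 (interior_subset hw1)

end limitShape

/-! ### Lipschitz graphs -/

/-- The height of the point `z` above the graph of `φ`. -/
def graphHeight (φ : EuclideanSpace ℝ (Fin 2) → ℝ) (z : E3) : ℝ :=
  z 2 - φ !₂[z 0, z 1]

theorem lipschitzWith_fst_two : LipschitzWith 1 fun z : E3 => !₂[z 0, z 1] := by
  refine LipschitzWith.of_dist_le_mul fun x y => ?_
  rw [NNReal.coe_one, one_mul, EuclideanSpace.dist_eq, EuclideanSpace.dist_eq]
  refine Real.sqrt_le_sqrt ?_
  simp only [Fin.sum_univ_two, Fin.sum_univ_three]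
  simp

theorem lipschitzWith_graphHeight {φ : EuclideanSpace ℝ (Fin 2) → ℝ} {L : ℝ≥0}
    (hφ : LipschitzWith L φ) : LipschitzWith (1 + L) (graphHeight φ) := by
  have h1 : LipschitzWith 1 fun z : E3 => z 2 := by
    refine LipschitzWith.of_dist_le_mul fun x y => ?_
    simpa [dist_eq_norm] using PiLp.norm_apply_le (x - y) 2
  have := h1.sub (hφ.comp lipschitzWith_fst_two)
  rwa [mul_one] at this

theorem lipschitzWith_graphHeight_isometry {φ : EuclideanSpace ℝ (Fin 2) → ℝ} {L : ℝ≥0}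
    (hφ : LipschitzWith L φ) (R : E3 ≃ₗᵢ[ℝ] E3) (x₀ : E3) :
    LipschitzWith (1 + L) fun x => graphHeight φ (R (x - x₀)) := by
  refine LipschitzWith.of_dist_le_mul fun x y => ?_
  have := (lipschitzWith_graphHeight hφ).dist_le_mul (R (x - x₀)) (R (y - x₀))
  rwa [R.dist_map, dist_sub_right] at this

theorem graphHeight_add_vertical (φ : EuclideanSpace ℝ (Fin 2) → ℝ) (z : E3) (t : ℝ) :
    graphHeight φ (z + t • EuclideanSpace.single 2 1) = graphHeight φ z + t := by
  simp [graphHeight]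
  ring

theorem isLipschitzEpigraphNear_iff {U : Set E3} {L : ℝ≥0} {r : ℝ} {x₀ : E3} :
    IsLipschitzEpigraphNear U L r x₀ ↔
      ∃ (R : E3 ≃ₗᵢ[ℝ] E3) (φ : EuclideanSpace ℝ (Fin 2) → ℝ), LipschitzWith L φ ∧
        ∀ x ∈ ball x₀ r, (x ∈ U ↔ 0 < graphHeight φ (R (x - x₀))) := by
  simp only [IsLipschitzEpigraphNear, graphHeight, sub_pos]

/-- Shows that a chart centred at a boundary point has `φ 0 = 0`, the normalization needed for the
convergence of the chart functions. -/
theorem graphHeight_eq_zero_of_mem_frontier {U : Set E3} (hU : IsOpen U) {F : E3 → ℝ}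
    (hF : Continuous F) {r : ℝ} (hr : 0 < r) {x₀ : E3} (hx₀ : x₀ ∈ frontier U)
    (h : ∀ x ∈ ball x₀ r, (x ∈ U ↔ 0 < F x)) : F x₀ = 0 := by
  rw [hU.frontier_eq] at hx₀
  refine le_antisymm (not_lt.1 fun h' => hx₀.2 ((h x₀ (mem_ball_self hr)).2 h')) ?_
  by_contra! hneg
  obtain ⟨y, ⟨hy1, hy2⟩, hyU⟩ := mem_closure_iff.1 hx₀.1 (ball x₀ r ∩ {x | F x < 0})
    (isOpen_ball.inter (isOpen_lt hF continuous_const)) ⟨mem_ball_self hr, hneg⟩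
  exact lt_asymm hy2 ((h y hy1).1 hyU)

/-- The vertical shift by `1 / (n + 1)` moves the graph to the level set of height `1 / (n + 1)`.
These infinitely many translates, by bounded vectors, are pairwise disjoint, so the graph is null.
-/
theorem volume_graph_eq_zero {φ : EuclideanSpace ℝ (Fin 2) → ℝ} {L : ℝ≥0}
    (hφ : LipschitzWith L φ) (R : E3 ≃ₗᵢ[ℝ] E3) (x₀ : E3) :
    volume {x | graphHeight φ (R (x - x₀)) = 0} = 0 := by
  set e : E3 := R.symm (EuclideanSpace.single 2 1)
  have hc : Continuous fun x => graphHeight φ (R (x - x₀)) :=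
    (lipschitzWith_graphHeight_isometry hφ R x₀).continuous
  refine Measure.addHaar_eq_zero_of_disjoint_translates volume
    (fun n : ℕ => ((1 : ℝ) / (n + 1)) • e) ?_ ?_ (isClosed_eq hc continuous_const).measurableSet
  · refine (isBounded_closedBall (x := (0 : E3)) (r := ‖e‖)).subset ?_
    rintro _ ⟨n, rfl⟩
    rw [mem_closedBall, dist_zero_right, norm_smul]
    refine mul_le_of_le_one_left (norm_nonneg e) ?_
    rw [Real.norm_of_nonneg (by positivity)]
    exact (div_le_one (by positivity)).2 (by linarith [n.cast_nonneg (α := ℝ)])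
  · have key : ∀ n : ℕ, ∀ x ∈ ({((1 : ℝ) / (n + 1)) • e} : Set E3) +
        {x | graphHeight φ (R (x - x₀)) = 0},
        graphHeight φ (R (x - x₀)) = 1 / (n + 1) := by
      intro n x hx
      rw [singleton_add] at hx
      obtain ⟨y, hy, rfl⟩ := hx
      have : R (((1 : ℝ) / (n + 1)) • e + y - x₀)
          = R (y - x₀) + ((1 : ℝ) / (n + 1)) • EuclideanSpace.single 2 1 := by
        rw [add_sub_assoc, map_add, map_smul, add_comm]
        simp [e]
      rw [this, graphHeight_add_vertical, show graphHeight φ (R (y - x₀)) = 0 from hy, zero_add]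
    intro m n hmn
    rw [Function.onFun, Set.disjoint_left]
    intro x hxm hxn
    have := (key m x hxm).symm.trans (key n x hxn)
    field_simp at this
    exact hmn (by exact_mod_cast (add_right_cancel this).symm)

/-! ### Compactness of the uniformly Lipschitz sets -/

section compactness

variable {ι : Type*} {𝒰 : Ultrafilter ι} {ω : ι → Set E3} {L : ℝ≥0} {r : ℝ}

/-- The frontiers of the `ω n` come arbitrarily close to `x₀`. Charts at nearest frontier points `y
n` therefore have centres tending to `x₀`, and their rotations and graph functions converge along
`𝒰`. As all charts are valid on balls of the same radius `r`, so is the limit chart. -/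
theorem exists_graph_near_limit (hr : 0 < r) (hopen : ∀ n, IsOpen (ω n))
    (hlip : ∀ n, IsUniformlyLipschitz L r (ω n)) {x₀ : E3} (h1 : x₀ ∉ limitShape 𝒰 ω)
    (h2 : x₀ ∉ limitShape 𝒰 fun n => (ω n)ᶜ) :
    ∃ (R : E3 ≃ₗᵢ[ℝ] E3) (φ : EuclideanSpace ℝ (Fin 2) → ℝ), LipschitzWith L φ ∧
      ∀ x ∈ ball x₀ r,
        (0 < graphHeight φ (R (x - x₀)) → x ∈ limitShape 𝒰 ω) ∧
        (graphHeight φ (R (x - x₀)) < 0 → x ∈ limitShape 𝒰 fun n => (ω n)ᶜ) := by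
  have hsel : ∀ n, ∃ (y : E3) (R : E3 ≃ₗᵢ[ℝ] E3) (φ : EuclideanSpace ℝ (Fin 2) → ℝ),
      LipschitzWith L φ ∧ φ 0 = 0 ∧ ((frontier (ω n)).Nonempty →
        infDist x₀ (frontier (ω n)) = dist x₀ y ∧
        ∀ x ∈ ball y r, (x ∈ ω n ↔ 0 < graphHeight φ (R (x - y)))) := by
    intro n
    by_cases hne : (frontier (ω n)).Nonempty
    · obtain ⟨y, hy, hdist⟩ := isClosed_frontier.exists_infDist_eq_dist hne x₀
      obtain ⟨R, φ, hφ, h⟩ := isLipschitzEpigraphNear_iff.1 (hlip n y hy)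
      refine ⟨y, R, φ, hφ, ?_, fun _ => ⟨hdist, h⟩⟩
      have := graphHeight_eq_zero_of_mem_frontier (hopen n)
        (lipschitzWith_graphHeight_isometry hφ R y).continuous hr hy h
      have h0 : (!₂[0, 0] : EuclideanSpace ℝ (Fin 2)) = 0 := by ext i; fin_cases i <;> rfl
      simpa [graphHeight, h0] using this
    · exact ⟨x₀, LinearIsometryEquiv.refl ℝ E3, fun _ => 0, LipschitzWith.const' 0, rfl,
        fun h => absurd h hne⟩
  choose y R φ hφ hφ0 hy using hsel
  obtain ⟨S, hS⟩ := exists_tendsto_linearIsometryEquiv 𝒰 R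
  obtain ⟨ψ, hψ, hψlim⟩ := exists_tendsto_lipschitzWith 𝒰 hφ hφ0
  have hfront := fun δ (hδ : (0 : ℝ) < δ) => eventually_nonempty_ball_inter_frontier h1 h2 hδ
  have hylim : Tendsto y 𝒰 (𝓝 x₀) := by
    refine Metric.tendsto_nhds.2 fun δ hδ => ?_
    filter_upwards [hfront δ hδ] with n hn
    obtain ⟨z, hz, hzf⟩ := hn
    rw [dist_comm, ← (hy n ⟨z, hzf⟩).1]
    exact (infDist_le_dist_of_mem hzf).trans_lt (mem_ball'.1 hz)
  have hchart : ∀ᶠ n in (𝒰 : Filter ι), ∀ x ∈ ball (y n) r,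
      (x ∈ ω n ↔ 0 < graphHeight (φ n) (R n (x - y n))) := by
    filter_upwards [hfront 1 one_pos] with n hn
    exact (hy n (hn.mono inter_subset_right)).2
  have hF := fun n => lipschitzWith_graphHeight_isometry (hφ n) (R n) (y n)
  have hlim : ∀ x, Tendsto (fun n => graphHeight (φ n) (R n (x - y n))) 𝒰
      (𝓝 (graphHeight ψ (S (x - x₀)))) := by
    intro x
    have hRlim : Tendsto (fun n => R n (x - y n)) 𝒰 (𝓝 (S (x - x₀))) := by
      have h3 : Tendsto (fun n => R n (x₀ - y n)) 𝒰 (𝓝 0) := by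
        rw [tendsto_zero_iff_norm_tendsto_zero]
        simp only [LinearIsometryEquiv.norm_map]
        simpa using ((tendsto_const_nhds (x := x₀)).sub hylim).norm
      simpa [← map_add] using (hS (x - x₀)).add h3
    -- Both the functions and their arguments vary. The functions converge at the fixed point `S (x
    -- - x₀)`, and their common Lipschitz constant absorbs the change of argument.
    have h4 : Tendsto (fun n => graphHeight (φ n) (S (x - x₀))) 𝒰
        (𝓝 (graphHeight ψ (S (x - x₀)))) := tendsto_const_nhds.sub (hψlim _)
    refine tendsto_of_tendsto_of_dist h4 ?_
    have h5 : Tendsto (fun n => ((1 + L : ℝ≥0) : ℝ) * dist (S (x - x₀)) (R n (x - y n))) 𝒰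
        (𝓝 0) := by
      simpa using (((tendsto_const_nhds (x := S (x - x₀))).dist hRlim).const_mul
        ((1 + L : ℝ≥0) : ℝ))
    exact squeeze_zero (fun _ => dist_nonneg)
      (fun n => (lipschitzWith_graphHeight (hφ n)).dist_le_mul _ _) h5
  refine ⟨S, ψ, hψ, fun x hx => ⟨fun hpos => ?_, fun hneg => ?_⟩⟩
  · refine mem_limitShape_of_tendsto hylim hF hlim ?_ hx hpos
    filter_upwards [hchart] with n hn z hz hzpos
    exact (hn z hz).2 hzpos
  -- The region below the graph is treated as the region above, with the heights negated and the
  -- complements as sets.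
  · refine mem_limitShape_of_tendsto hylim (fun n => (hF n).neg) (fun z => (hlim z).neg) ?_ hx
      (neg_pos.2 hneg)
    filter_upwards [hchart] with n hn z hz hzpos hzω
    have := (hn z hz).1 hzω
    simp only [Pi.neg_apply] at hzpos
    linarith

/-- A frontier point of the limit lies in neither limit, since these are open and disjoint, so the
limit chart applies there. Only points on the graph itself remain to be excluded from the limit
shape. -/
theorem isUniformlyLipschitz_limitShape (hr : 0 < r) (hopen : ∀ n, IsOpen (ω n))
    (hlip : ∀ n, IsUniformlyLipschitz L r (ω n)) :
    IsUniformlyLipschitz L r (limitShape 𝒰 ω) := by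
  intro x₀ hx₀
  rw [isOpen_limitShape.frontier_eq] at hx₀
  have hdisj := disjoint_limitShape_compl (𝒰 := 𝒰) (ω := ω)
  have hdisj' := hdisj.closure_left isOpen_limitShape
  obtain ⟨R, φ, hφ, h⟩ := exists_graph_near_limit hr hopen hlip hx₀.2
    (Set.disjoint_left.1 hdisj' hx₀.1)
  refine isLipschitzEpigraphNear_iff.2 ⟨R, φ, hφ, fun x hx => ⟨fun hxω => ?_, (h x hx).1⟩⟩
  rcases lt_trichotomy (graphHeight φ (R (x - x₀))) 0 with hlt | heq | hgt
  · exact absurd ((h x hx).2 hlt) (Set.disjoint_left.1 hdisj hxω)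
  -- By openness, a point of the limit shape on the graph could be pushed slightly below it without
  -- leaving the limit shape; but points below the graph belong to the limit of the complements.
  · exfalso
    set e : E3 := R.symm (EuclideanSpace.single 2 1)
    have hc : ContinuousAt (fun t : ℝ => x + t • e) 0 := by fun_prop
    have hmem : limitShape 𝒰 ω ∩ ball x₀ r ∈ 𝓝 (x + (0 : ℝ) • e) := by
      rw [zero_smul, add_zero]
      exact (isOpen_limitShape.inter isOpen_ball).mem_nhds ⟨hxω, hx⟩
    have h3 : ∀ᶠ t : ℝ in 𝓝[<] 0, x + t • e ∈ limitShape 𝒰 ω ∩ ball x₀ r :=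
      (hc.eventually hmem).filter_mono nhdsWithin_le_nhds
    obtain ⟨t, ⟨ht1, ht2⟩, ht0⟩ := (h3.and self_mem_nhdsWithin).exists
    refine Set.disjoint_left.1 hdisj ht1 ((h _ ht2).2 ?_)
    have : R (x + t • e - x₀) = R (x - x₀) + t • EuclideanSpace.single 2 1 := by
      rw [add_sub_right_comm, map_add, map_smul]
      simp [e]
    rw [this, graphHeight_add_vertical, heq, zero_add]
    exact ht0
  · exact hgt

/-- Locally, points in neither limit lie on the graph of the limit chart, which is null. -/
theorem volume_compl_limitShape_union (hr : 0 < r) (hopen : ∀ n, IsOpen (ω n))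
    (hlip : ∀ n, IsUniformlyLipschitz L r (ω n)) :
    volume (limitShape 𝒰 ω ∪ limitShape 𝒰 fun n => (ω n)ᶜ)ᶜ = 0 := by
  refine measure_null_of_locally_null _ fun x₀ hx₀ => ?_
  rw [mem_compl_iff, mem_union, not_or] at hx₀
  obtain ⟨R, φ, hφ, h⟩ := exists_graph_near_limit hr hopen hlip hx₀.1 hx₀.2
  refine ⟨_, inter_mem_nhdsWithin _ (ball_mem_nhds x₀ hr),
    measure_mono_null ?_ (volume_graph_eq_zero hφ R x₀)⟩
  rintro x ⟨hx, hxb⟩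
  rw [mem_compl_iff, mem_union, not_or] at hx
  exact le_antisymm (not_lt.1 fun h' => hx.1 ((h x hxb).1 h'))
    (not_lt.1 fun h' => hx.2 ((h x hxb).2 h'))

/-- Compact sets fill the two limits, within a ball around `B`, up to volume `ε / 2` each. Almost
every `ω n` contains the first compact set and misses the second, so it can differ from the limit
shape only on the two remainders and a null set. -/
theorem tendsto_volume_symmDiff_limitShape {B : Set E3} (hB : Bornology.IsBounded B)
    (hr : 0 < r) (hsub : ∀ n, ω n ⊆ B) (hopen : ∀ n, IsOpen (ω n))
    (hlip : ∀ n, IsUniformlyLipschitz L r (ω n)) :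
    Tendsto (fun n => volume (symmDiff (ω n) (limitShape 𝒰 ω))) 𝒰 (𝓝 0) := by
  obtain ⟨ρ, hρ⟩ := hB.subset_ball 0
  have happrox : ∀ {ε : ℝ≥0∞}, ε ≠ 0 → ∀ V : Set E3, IsOpen V →
      ∃ K ⊆ V ∩ ball 0 ρ, IsCompact K ∧ volume ((V ∩ ball 0 ρ) \ K) < ε := by
    intro ε hε V hV
    have hW : IsOpen (V ∩ ball 0 ρ) := hV.inter isOpen_ball
    exact hW.measurableSet.exists_isCompact_sdiff_lt
      ((measure_mono inter_subset_right).trans_lt measure_ball_lt_top).ne hε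
  refine ENNReal.tendsto_nhds_zero.2 fun ε hε => ?_
  have hε2 : ε / 2 ≠ 0 := (ENNReal.half_pos hε.ne').ne'
  obtain ⟨K, hKV, hK, hKε⟩ := happrox hε2 (limitShape 𝒰 ω) isOpen_limitShape
  obtain ⟨K', hKV', hK', hKε'⟩ := happrox hε2 (limitShape 𝒰 fun n => (ω n)ᶜ) isOpen_limitShape
  filter_upwards [hK.eventually_subset_of_subset_limitShape (hKV.trans inter_subset_left),
    hK'.eventually_subset_of_subset_limitShape (hKV'.trans inter_subset_left)] with n hn hn'
  have hcover : symmDiff (ω n) (limitShape 𝒰 ω) ⊆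
      ((limitShape 𝒰 ω ∩ ball 0 ρ) \ K ∪ ((limitShape 𝒰 fun n => (ω n)ᶜ) ∩ ball 0 ρ) \ K') ∪
        (limitShape 𝒰 ω ∪ limitShape 𝒰 fun n => (ω n)ᶜ)ᶜ := by
    rintro x (⟨hxω, hx⟩ | ⟨hx, hxω⟩)
    · by_cases hx' : x ∈ limitShape 𝒰 fun n => (ω n)ᶜ
      · exact Or.inl (Or.inr ⟨⟨hx', hρ (hsub n hxω)⟩, fun hxK => hn' hxK hxω⟩)
      · exact Or.inr fun h => h.elim hx hx'
    · exact Or.inl (Or.inl ⟨⟨hx, hρ (limitShape_subset hsub hx)⟩, fun hxK => hxω (hn hxK)⟩)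
  calc volume (symmDiff (ω n) (limitShape 𝒰 ω))
      ≤ _ := measure_mono hcover
    _ ≤ _ := measure_union_le _ _
    _ ≤ (ε / 2 + ε / 2) + 0 := by
        refine add_le_add ((measure_union_le _ _).trans (add_le_add hKε.le hKε'.le)) ?_
        rw [volume_compl_limitShape_union hr hopen hlip]
    _ = ε := by rw [add_zero, ENNReal.add_halves]

end compactness

end

/-! ### Monotone operators: the dual map, unique solvability, multiplication on square integrable
fields. -/

noncomputable section

open Filter Topology

/-! ### The regularized maximum and the penalized dual variable -/

theorem maxReg_eq_one {γ s : ℝ} (hγ : 0 < γ) (h : s - 1 ≤ -(1 / (2 * γ))) : maxReg γ s = 1 := by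
  have hd : 0 < 1 / (2 * γ) := by positivity
  rw [maxReg, if_neg (by linarith)]
  split_ifs with h'
  · have : s - 1 + 1 / (2 * γ) = 0 := by linarith [(abs_le.1 h').1]
    rw [this]
    ring
  · rfl

theorem maxReg_eq_self {γ s : ℝ} (h : 1 / (2 * γ) ≤ s - 1) : maxReg γ s = s :=
  if_pos h

theorem maxReg_eq_quadratic {γ s : ℝ} (h1 : -(1 / (2 * γ)) ≤ s - 1) (h2 : s - 1 < 1 / (2 * γ)) :
    maxReg γ s = 1 + γ / 2 * (s - 1 + 1 / (2 * γ)) ^ 2 := by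
  rw [maxReg, if_neg (not_le.2 h2), if_pos (abs_le.2 ⟨h1, h2.le⟩)]

/-- With `d = 1 / (2 * γ)`, the constant, quadratic and identity pieces join continuously at `1 - d`
and `1 + d`, and the slope of the quadratic piece runs from `0` to `2 * γ * d = 1`. -/
theorem maxReg_monotone_and_slope {γ s t : ℝ} (hγ : 0 < γ) (hst : s ≤ t) :
    maxReg γ s ≤ maxReg γ t ∧ maxReg γ t - maxReg γ s ≤ t - s := by
  have hd : 0 < 1 / (2 * γ) := by positivity
  have hγd : γ * (1 / (2 * γ)) = 1 / 2 := by field_simp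
  have e1 := @maxReg_eq_one γ
  have e2 := @maxReg_eq_quadratic γ
  have e3 := @maxReg_eq_self γ
  generalize 1 / (2 * γ) = d at *
  have key : ∀ p q : ℝ, 0 ≤ p → p ≤ q → q ≤ 2 * d →
      γ / 2 * p ^ 2 ≤ γ / 2 * q ^ 2 ∧ γ / 2 * q ^ 2 - γ / 2 * p ^ 2 ≤ q - p := by
    intro p q hp hpq hq
    refine ⟨by gcongr, ?_⟩
    have h1 : γ / 2 * q ^ 2 - γ / 2 * p ^ 2 = γ / 2 * (q + p) * (q - p) := by ring
    have h2 : γ / 2 * (q + p) ≤ 1 := by nlinarith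
    rw [h1]
    exact mul_le_of_le_one_left (by linarith) h2
  -- The quadratic piece ends at the value `1 + d`, where the identity takes over.
  have hend : γ / 2 * (2 * d) ^ 2 = d := by linear_combination 2 * d * hγd
  rcases le_or_gt (s - 1) (-d) with hs1 | hs1
  · rcases le_or_gt (t - 1) (-d) with ht1 | ht1
    · rw [e1 hγ hs1, e1 hγ ht1]
      exact ⟨le_rfl, by linarith⟩
    rcases lt_or_ge (t - 1) d with ht2 | ht2
    · rw [e1 hγ hs1, e2 ht1.le ht2]
      have := key 0 (t - 1 + d) le_rfl (by linarith) (by linarith)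
      constructor <;> linarith
    · rw [e1 hγ hs1, e3 ht2]
      constructor <;> linarith
  rcases lt_or_ge (s - 1) d with hs2 | hs2
  · rcases lt_or_ge (t - 1) d with ht2 | ht2
    · rw [e2 hs1.le hs2, e2 (by linarith) ht2]
      have := key (s - 1 + d) (t - 1 + d) (by linarith) (by linarith) (by linarith)
      constructor <;> linarith
    · rw [e2 hs1.le hs2, e3 ht2]
      have := key (s - 1 + d) (2 * d) (by linarith) (by linarith) (by linarith)
      constructor <;> linarith
  · rw [e3 hs2, e3 (by linarith)]
    exact ⟨hst, le_rfl⟩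

theorem one_le_maxReg {γ : ℝ} (hγ : 0 < γ) (s : ℝ) : 1 ≤ maxReg γ s := by
  have h := (maxReg_monotone_and_slope hγ (min_le_left s (1 - 1 / (2 * γ)))).1
  rwa [maxReg_eq_one hγ (by linarith [min_le_right s (1 - 1 / (2 * γ))])] at h

/-- As the slope is at most one, `maxReg γ s - s` is nonincreasing, and it vanishes for large `s`.
-/
theorem le_maxReg {γ : ℝ} (hγ : 0 < γ) (s : ℝ) : s ≤ maxReg γ s := by
  have h := (maxReg_monotone_and_slope hγ (le_max_left s (1 + 1 / (2 * γ)))).2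
  rw [maxReg_eq_self (by linarith [le_max_right s (1 + 1 / (2 * γ))])] at h
  linarith

theorem abs_maxReg_sub_le {γ : ℝ} (hγ : 0 < γ) (s t : ℝ) :
    |maxReg γ s - maxReg γ t| ≤ |s - t| := by
  rcases le_total s t with h | h
  · obtain ⟨h1, h2⟩ := maxReg_monotone_and_slope hγ h
    rw [abs_sub_comm, abs_sub_comm s, abs_of_nonneg (by linarith), abs_of_nonneg (by linarith)]
    exact h2
  · obtain ⟨h1, h2⟩ := maxReg_monotone_and_slope hγ h
    rw [abs_of_nonneg (by linarith), abs_of_nonneg (by linarith)]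
    exact h2

/-- Makes the radial part of `dualMap` nondecreasing: `s * maxReg γ t` is at most `s * maxReg γ s +
s * (t - s)`, and `s ≤ maxReg γ s`. -/
theorem mul_maxReg_le {γ s t : ℝ} (hγ : 0 < γ) (hs : 0 ≤ s) (hst : s ≤ t) :
    s * maxReg γ t ≤ t * maxReg γ s := by
  have h1 := (maxReg_monotone_and_slope hγ hst).2
  have h2 := le_maxReg hγ s
  nlinarith

theorem dualMap_zero (j γ : ℝ) : dualMap j γ 0 = 0 := by
  simp [dualMap]

theorem norm_dualMap_le {j γ : ℝ} (hj : 0 ≤ j) (hγ : 0 < γ) (e : E3) : ‖dualMap j γ e‖ ≤ j := by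
  have h1 := one_le_maxReg hγ (γ * ‖e‖)
  have h2 := le_maxReg hγ (γ * ‖e‖)
  rw [dualMap, norm_smul, Real.norm_of_nonneg (by positivity), div_mul_eq_mul_div,
    div_le_iff₀ (by linarith), mul_assoc]
  exact mul_le_mul_of_nonneg_left h2 hj

theorem norm_dualMap_sub_le {j γ : ℝ} (hj : 0 ≤ j) (hγ : 0 < γ) (e e' : E3) :
    ‖dualMap j γ e - dualMap j γ e'‖ ≤ 2 * j * γ * ‖e - e'‖ := by
  have h1 := one_le_maxReg hγ (γ * ‖e‖)
  have h1' := one_le_maxReg hγ (γ * ‖e'‖)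
  have h2' := le_maxReg hγ (γ * ‖e'‖)
  have h3 : |maxReg γ (γ * ‖e'‖) - maxReg γ (γ * ‖e‖)| ≤ γ * ‖e - e'‖ := by
    refine (abs_maxReg_sub_le hγ _ _).trans ?_
    rw [← mul_sub, abs_mul, abs_of_pos hγ, abs_sub_comm]
    exact mul_le_mul_of_nonneg_left (abs_norm_sub_norm_le e e') hγ.le
  unfold dualMap
  generalize maxReg γ (γ * ‖e‖) = m at *
  generalize maxReg γ (γ * ‖e'‖) = m' at *
  have hm : 0 < m := by linarith
  have hm' : 0 < m' := by linarith
  -- The change of the vector and the change of the coefficient contribute `j * γ` each, hence the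
  -- factor `2`.
  have hsplit : (j * γ / m) • e - (j * γ / m') • e'
      = (j * γ / m) • (e - e') + (j * γ / m - j * γ / m') • e' := by
    rw [smul_sub, sub_smul]
    abel
  have ha : ‖(j * γ / m) • (e - e')‖ ≤ j * γ * ‖e - e'‖ := by
    rw [norm_smul, Real.norm_of_nonneg (by positivity)]
    gcongr
    exact div_le_self (by positivity) h1
  have hb : ‖(j * γ / m - j * γ / m') • e'‖ ≤ j * γ * ‖e - e'‖ := by
    have hq : j * γ / m - j * γ / m' = j * ((m' - m) / (m * m')) * γ := by
      field_simp
    rw [norm_smul, hq, Real.norm_eq_abs, abs_mul, abs_mul, abs_div, abs_of_nonneg hj,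
      abs_of_pos hγ, abs_of_pos (mul_pos hm hm')]
    calc j * (|m' - m| / (m * m')) * γ * ‖e'‖
        = j * |m' - m| * ((γ * ‖e'‖) / (m * m')) := by ring
      _ ≤ j * (γ * ‖e - e'‖) * 1 := by
          gcongr
          rw [div_le_one (by positivity)]
          nlinarith
      _ = j * γ * ‖e - e'‖ := by ring
  rw [hsplit]
  refine (norm_add_le _ _).trans ?_
  linarith

theorem lipschitzWith_dualMap {j γ : ℝ} (hj : 0 ≤ j) (hγ : 0 < γ) :
    LipschitzWith (2 * j * γ).toNNReal (dualMap j γ) := by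
  refine LipschitzWith.of_dist_le_mul fun e e' => ?_
  rw [Real.coe_toNNReal _ (by positivity), dist_eq_norm, dist_eq_norm]
  exact norm_dualMap_sub_le hj hγ e e'

/-- With `a`, `b` the scalar coefficients of `e`, `e'`, Cauchy–Schwarz bounds the inner product
below by `(a * ‖e‖ - b * ‖e'‖) * (‖e‖ - ‖e'‖)`, whose factors have the same sign. -/
theorem inner_dualMap_sub_nonneg {j γ : ℝ} (hj : 0 ≤ j) (hγ : 0 < γ) (e e' : E3) :
    0 ≤ inner ℝ (dualMap j γ e - dualMap j γ e') (e - e') := by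
  wlog hle : ‖e‖ ≤ ‖e'‖ generalizing e e' with H
  · have := H e' e (le_of_not_ge hle)
    rwa [← neg_sub (dualMap j γ e), ← neg_sub e, inner_neg_neg] at this
  have h1 := one_le_maxReg hγ (γ * ‖e‖)
  have h1' := one_le_maxReg hγ (γ * ‖e'‖)
  have hmono := mul_maxReg_le hγ (by positivity)
    (mul_le_mul_of_nonneg_left hle hγ.le : γ * ‖e‖ ≤ γ * ‖e'‖)
  unfold dualMap
  generalize maxReg γ (γ * ‖e‖) = m at *
  generalize maxReg γ (γ * ‖e'‖) = m' at *
  have hm : 0 < m := by linarith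
  have hm' : 0 < m' := by linarith
  have hρ : j * γ / m * ‖e‖ ≤ j * γ / m' * ‖e'‖ := by
    rw [div_mul_eq_mul_div, div_mul_eq_mul_div, div_le_div_iff₀ hm hm']
    nlinarith
  have ha : 0 ≤ j * γ / m := by positivity
  have hb : 0 ≤ j * γ / m' := by positivity
  generalize j * γ / m = a at *
  generalize j * γ / m' = b at *
  have hexp : inner ℝ (a • e - b • e') (e - e')
      = a * ‖e‖ ^ 2 + b * ‖e'‖ ^ 2 - (a + b) * inner ℝ e e' := by
    simp only [inner_sub_left, inner_sub_right, real_inner_smul_left, real_inner_self_eq_norm_sq,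
      real_inner_comm e e']
    ring
  rw [hexp]
  have hcs := mul_le_mul_of_nonneg_left (real_inner_le_norm e e') (add_nonneg ha hb)
  nlinarith

/-! ### Strongly monotone Lipschitz operators on a Hilbert space -/

section monotone

variable {H : Type*} [NormedAddCommGroup H] [InnerProductSpace ℝ H]

/-- Zarantonello's argument: for `t = c / M ^ 2` the map `u ↦ u - t • (A u - F)` contracts with
factor `√(1 - c ^ 2 / M ^ 2)`, and its fixed points are the solutions. -/
theorem existsUnique_of_stronglyMonotone [CompleteSpace H] {A : H → H} {K : ℝ≥0} {c : ℝ}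
    (hA : LipschitzWith K A) (hc : 0 < c)
    (hmono : ∀ u v, c * ‖u - v‖ ^ 2 ≤ inner ℝ (A u - A v) (u - v)) (F : H) :
    ∃! u, A u = F := by
  -- Enlarging `K` by `c` secures `0 < M` and `c ≤ M`, even in a trivial space where `K` may be
  -- smaller than `c`.
  set M : ℝ := K + c
  have hM : 0 < M := add_pos_of_nonneg_of_pos K.2 hc
  set t : ℝ := c / M ^ 2
  have hcM : c ^ 2 / M ^ 2 ≤ 1 := by
    rw [div_le_one (by positivity)]
    have : c ≤ M := le_add_of_nonneg_left K.2
    gcongr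
  set q : ℝ := 1 - c ^ 2 / M ^ 2
  have hq0 : 0 ≤ q := sub_nonneg.2 hcM
  have hq1 : q < 1 := sub_lt_self _ (by positivity)
  have hstep : ∀ u v, ‖(u - t • (A u - F)) - (v - t • (A v - F))‖ ≤ √q * ‖u - v‖ := by
    intro u v
    have hlip : ‖A u - A v‖ ^ 2 ≤ M ^ 2 * ‖u - v‖ ^ 2 := by
      rw [← mul_pow]
      refine pow_le_pow_left₀ (norm_nonneg _) ((hA.norm_sub_le u v).trans ?_) 2
      gcongr
      exact le_add_of_nonneg_right hc.le
    have heq : (u - t • (A u - F)) - (v - t • (A v - F)) = (u - v) - t • (A u - A v) := by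
      simp only [smul_sub]
      abel
    have hsq : ‖(u - v) - t • (A u - A v)‖ ^ 2 ≤ q * ‖u - v‖ ^ 2 := by
      rw [norm_sub_sq_real, norm_smul, mul_pow, real_inner_smul_right, real_inner_comm,
        Real.norm_eq_abs, sq_abs]
      have ht : 0 ≤ t := by positivity
      have h1 := mul_le_mul_of_nonneg_left (hmono u v) ht
      have h2 := mul_le_mul_of_nonneg_left hlip (sq_nonneg t)
      have h3 : t * c = c ^ 2 / M ^ 2 := by simp only [t]; ring
      have h4 : t ^ 2 * M ^ 2 = c ^ 2 / M ^ 2 := by simp only [t]; field_simp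
      rw [← mul_assoc, h3] at h1
      rw [← mul_assoc, h4] at h2
      simp only [q]
      linarith
    rw [heq]
    refine abs_le_of_sq_le_sq' ?_ (by positivity) |>.2
    rw [mul_pow, Real.sq_sqrt hq0]
    exact hsq
  have hcontr : ContractingWith (√q).toNNReal fun u => u - t • (A u - F) := by
    refine ⟨?_, LipschitzWith.of_dist_le_mul fun u v => ?_⟩
    · exact Real.toNNReal_lt_one.2 ((Real.sqrt_lt_sqrt hq0 hq1).trans_eq Real.sqrt_one)
    · rw [dist_eq_norm, dist_eq_norm, Real.coe_toNNReal _ (Real.sqrt_nonneg q)]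
      exact hstep u v
  have hfix := hcontr.fixedPoint_isFixedPt
  refine ⟨hcontr.fixedPoint, ?_, fun v hv => ?_⟩
  · have h1 : t • (A hcontr.fixedPoint - F) = 0 := sub_eq_self.1 hfix
    exact sub_eq_zero.1 ((smul_eq_zero.1 h1).resolve_left (by positivity))
  · refine hcontr.fixedPoint_unique ?_
    change v - t • (A v - F) = v
    rw [hv, sub_self, smul_zero, sub_zero]

/-- Stability under a change of operator: only the difference of the two operators at the reference
solution `u'` enters. -/
theorem mul_norm_sub_le_of_stronglyMonotone {A A' : H → H} {c : ℝ}
    (hmono : ∀ u v, c * ‖u - v‖ ^ 2 ≤ inner ℝ (A u - A v) (u - v)) {u u' : H}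
    (h : A u = A' u') : c * ‖u - u'‖ ≤ ‖A' u' - A u'‖ := by
  rcases (norm_nonneg (u - u')).eq_or_lt with h0 | h0
  · rw [← h0, mul_zero]
    exact norm_nonneg _
  · refine le_of_mul_le_mul_right ?_ h0
    have := (hmono u u').trans (real_inner_le_norm _ _)
    rw [h] at this
    linarith

end monotone

/-! ### Multiplication operators on square integrable fields -/

variable {Ω : Set E3}

/-- Multiplication of square integrable fields by an essentially bounded operator function. -/
def mulOp {A : E3 → E3 →L[ℝ] E3} (hA : MemLp A ∞ (volume.restrict Ω)) :
    L2Field Ω →L[ℝ] L2Field Ω :=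
  (ContinuousLinearMap.id ℝ (E3 →L[ℝ] E3)).holderL (volume.restrict Ω) ∞ 2 2 (hA.toLp A)

section mulOp

variable {A : E3 → E3 →L[ℝ] E3} (hA : MemLp A ∞ (volume.restrict Ω))

theorem coeFn_mulOp (u : L2Field Ω) :
    mulOp hA u =ᵐ[volume.restrict Ω] fun x => A x (u x) := by
  have h := (ContinuousLinearMap.id ℝ (E3 →L[ℝ] E3)).coeFn_holder (r := 2) (hA.toLp A) u
  filter_upwards [h, hA.coeFn_toLp] with x hx hAx
  rw [hAx] at hx
  exact hx

theorem inner_mulOp (u v : L2Field Ω) :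
    inner ℝ (mulOp hA u) v = ∫ x in Ω, inner ℝ (A x (u x)) (v x) := by
  rw [L2.inner_def]
  refine integral_congr_ae ?_
  filter_upwards [coeFn_mulOp hA u] with x hx
  rw [hx]

theorem mul_norm_sq_le_inner_mulOp {a : ℝ}
    (ha : ∀ᵐ x ∂volume.restrict Ω, ∀ ξ, a * ‖ξ‖ ^ 2 ≤ inner ℝ (A x ξ) ξ) (u : L2Field Ω) :
    a * ‖u‖ ^ 2 ≤ inner ℝ (mulOp hA u) u := by
  rw [← real_inner_self_eq_norm_sq, L2.inner_def, L2.inner_def, ← integral_const_mul]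
  refine integral_mono_ae ((L2.integrable_inner (𝕜 := ℝ) u u).const_mul a)
    (L2.integrable_inner (𝕜 := ℝ) _ _) ?_
  filter_upwards [ha, coeFn_mulOp hA u] with x hx hu
  rw [hu, real_inner_self_eq_norm_sq]
  exact hx _

end mulOp

theorem memLp_top_indicator_id {ω : Set E3} (hω : MeasurableSet ω) :
    MemLp (ω.indicator fun _ => ContinuousLinearMap.id ℝ E3) ∞ (volume.restrict Ω) :=
  MemLp.indicator hω (memLp_top_const (ContinuousLinearMap.id ℝ E3))

/-- Restriction of square integrable fields to the measurable set `ω`, extended by zero. -/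
def cutoff {ω : Set E3} (hω : MeasurableSet ω) : L2Field Ω →L[ℝ] L2Field Ω :=
  mulOp (memLp_top_indicator_id hω)

theorem coeFn_cutoff {ω : Set E3} (hω : MeasurableSet ω) (u : L2Field Ω) :
    cutoff hω u =ᵐ[volume.restrict Ω] ω.indicator u := by
  filter_upwards [coeFn_mulOp (memLp_top_indicator_id hω) u] with x hx
  rw [cutoff, hx]
  by_cases h : x ∈ ω <;> simp [h]

/-- The difference vanishes off `symmDiff ω ω'` and is bounded by `C` there; boundedness of `g`
turns small volume into small norm at a rate. -/
theorem enorm_cutoff_sub_cutoff_le {ω ω' : Set E3} (hω : MeasurableSet ω)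
    (hω' : MeasurableSet ω') {g : L2Field Ω} {C : ℝ}
    (hg : ∀ᵐ x ∂volume.restrict Ω, ‖g x‖ ≤ C) :
    ‖cutoff hω g - cutoff hω' g‖ₑ ≤ ‖C‖ₑ * volume (symmDiff ω ω') ^ (1 / 2 : ℝ) := by
  rw [Lp.enorm_def]
  have hs : MeasurableSet (symmDiff ω ω') := hω.symmDiff hω'
  calc eLpNorm (cutoff hω g - cutoff hω' g : L2Field Ω) 2 (volume.restrict Ω)
      ≤ eLpNorm ((symmDiff ω ω').indicator fun _ => C) 2 (volume.restrict Ω) := by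
        refine eLpNorm_mono_ae ?_
        filter_upwards [hg, Lp.coeFn_sub (cutoff hω g) (cutoff hω' g), coeFn_cutoff hω g,
          coeFn_cutoff hω' g] with x hgx hx h1 h2
        have hC : ‖g x‖ ≤ ‖C‖ := hgx.trans (Real.le_norm_self C)
        rw [hx, Pi.sub_apply, h1, h2]
        by_cases hxω : x ∈ ω <;> by_cases hxω' : x ∈ ω' <;>
          simp [hxω, hxω', Set.mem_symmDiff] <;> simpa using hC
    _ = ‖C‖ₑ * volume.restrict Ω (symmDiff ω ω') ^ (1 / 2 : ℝ) := by
        rw [eLpNorm_indicator_const hs (by simp) (by simp)]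
        simp
    _ ≤ _ := by
        gcongr
        exact Measure.restrict_le_self

theorem inner_cutoff {ω : Set E3} (hω : MeasurableSet ω) (hωΩ : ω ⊆ Ω) (u v : L2Field Ω) :
    inner ℝ (cutoff hω u) v = ∫ x in ω, inner ℝ (u x) (v x) := by
  rw [L2.inner_def]
  have h : (fun x => inner ℝ (cutoff hω u x) (v x)) =ᵐ[volume.restrict Ω]
      ω.indicator fun x => inner ℝ (u x) (v x) := by
    filter_upwards [coeFn_cutoff hω u] with x hx
    rw [hx]
    by_cases hxω : x ∈ ω <;> simp [hxω]
  rw [integral_congr_ae h, setIntegral_indicator hω, inter_eq_self_of_subset_right hωΩ]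

end

/-! ### The state equation, its dependence on the shape, and the minimization. -/

noncomputable section

open Filter Topology

/-! ### The Hilbert space `H₀(curl)` -/

section H0curl

variable {Ω : Set E3}

theorem integral_inner_eq_inner_toLp (u : L2Field Ω) {g : E3 → E3}
    (hg : MemLp g 2 (volume.restrict Ω)) :
    ∫ x in Ω, inner ℝ (u x) (g x) = inner ℝ u (hg.toLp g) := by
  rw [L2.inner_def]
  refine integral_congr_ae ?_
  filter_upwards [hg.coeFn_toLp] with x hx
  rw [hx]

/-- Each test field imposes the equality of two continuous functionals of the pair. -/
theorem isClosed_Hcurl : IsClosed (Hcurl Ω : Set (L2Pair Ω)) := by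
  have h : (Hcurl Ω : Set (L2Pair Ω)) = ⋂ (φ : E3 → E3) (hφ : IsTestField Ω φ),
      {p | inner ℝ p.snd (hφ.memLp.toLp φ) = inner ℝ p.fst (hφ.memLp_curl.toLp (curl φ))} := by
    ext p
    simp only [mem_iInter, mem_ofPred_eq, ← integral_inner_eq_inner_toLp]
    rfl
  rw [h]
  refine isClosed_iInter fun φ => isClosed_iInter fun hφ => ?_
  exact isClosed_eq
    ((WithLp.sndL 2 ℝ (L2Field Ω) (L2Field Ω)).continuous.inner continuous_const)
    ((WithLp.fstL 2 ℝ (L2Field Ω) (L2Field Ω)).continuous.inner continuous_const)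

instance : CompleteSpace (H0curl Ω) := by
  have h : IsClosed (H0curl Ω : Set (L2Pair Ω)) :=
    isClosed_Hcurl.inter (Submodule.isClosed_topologicalClosure _)
  exact h.completeSpace_coe

/-- The embedding of `H₀(curl)` into the square integrable fields. -/
def fieldL (Ω : Set E3) : H0curl Ω →L[ℝ] L2Field Ω :=
  (WithLp.fstL 2 ℝ (L2Field Ω) (L2Field Ω)).comp (H0curl Ω).subtypeL

/-- The curl as a continuous linear map on `H₀(curl)`. -/
def rotL (Ω : Set E3) : H0curl Ω →L[ℝ] L2Field Ω :=
  (WithLp.sndL 2 ℝ (L2Field Ω) (L2Field Ω)).comp (H0curl Ω).subtypeL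

theorem norm_sq_H0curl (v : H0curl Ω) : ‖v‖ ^ 2 = ‖fieldL Ω v‖ ^ 2 + ‖rotL Ω v‖ ^ 2 :=
  WithLp.prod_norm_sq_eq_of_L2 v.1

end H0curl

/-! ### Material parameters and the dual variable as operators on square integrable fields -/

section operators

variable {Ω B : Set E3}

theorem inner_toEuclideanCLM (A : Matrix (Fin 3) (Fin 3) ℝ) (x y : E3) :
    inner ℝ (Matrix.toEuclideanCLM (n := Fin 3) (𝕜 := ℝ) A x) y = (A *ᵥ x.ofLp) ⬝ᵥ y.ofLp := by
  rw [EuclideanSpace.inner_eq_star_dotProduct, Matrix.ofLp_toEuclideanCLM, star_trivial,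
    dotProduct_comm]

theorem IsMaterialParameter.memLp_toEuclideanCLM {A : E3 → Matrix (Fin 3) (Fin 3) ℝ}
    (hA : IsMaterialParameter Ω B A) :
    MemLp (fun x => Matrix.toEuclideanCLM (n := Fin 3) (𝕜 := ℝ) (A x)) ∞
      (volume.restrict Ω) := by
  let T : (Fin 3 → Fin 3 → ℝ) →ₗ[ℝ] (E3 →L[ℝ] E3) :=
    { toFun := fun a => Matrix.toEuclideanCLM (n := Fin 3) (𝕜 := ℝ) (Matrix.of a)
      map_add' := fun a b => map_add (Matrix.toEuclideanCLM (n := Fin 3) (𝕜 := ℝ)) _ _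
      map_smul' := fun c a => map_smul (Matrix.toEuclideanCLM (n := Fin 3) (𝕜 := ℝ)) _ _ }
  have h : MemLp (fun x i j => A x i j) ∞ (volume.restrict Ω) :=
    memLp_pi_iff.2 fun i => memLp_pi_iff.2 fun j => hA.memLp_top i j
  exact (LinearMap.toContinuousLinearMap T).comp_memLp' h

theorem IsMaterialParameter.exists_mul_norm_sq_le {A : E3 → Matrix (Fin 3) (Fin 3) ℝ}
    (hA : IsMaterialParameter Ω B A) :
    ∃ a > 0, ∀ u : L2Field Ω,
      a * ‖u‖ ^ 2 ≤ inner ℝ (mulOp hA.memLp_toEuclideanCLM u) u := by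
  obtain ⟨a, ha, h⟩ := hA.posDef
  refine ⟨a, ha, mul_norm_sq_le_inner_mulOp _ ?_⟩
  filter_upwards [h] with x hx ξ
  rw [inner_toEuclideanCLM, dotProduct_comm]
  exact hx ξ

theorem IsC1.memLp_top {F : Type*} [NormedAddCommGroup F] [NormedSpace ℝ F] {u : E3 → F}
    (hB : IsOpen B) (hu : IsC1 B u) : MemLp u ∞ (volume.restrict B) := by
  obtain ⟨C, hC⟩ := hu.2
  refine memLp_top_of_bound (hu.1.continuousOn.aestronglyMeasurable hB.measurableSet) C ?_
  filter_upwards [ae_restrict_mem hB.measurableSet] with x hx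
  exact (hC x hx).1

theorem memLp_indicator_of_subset {F : Type*} [NormedAddCommGroup F] {u : E3 → F} {p : ℝ≥0∞}
    (hB : MeasurableSet B) (hBΩ : B ⊆ Ω) (hu : MemLp u p (volume.restrict B)) :
    MemLp (B.indicator u) p (volume.restrict Ω) := by
  rwa [memLp_indicator_iff_restrict hB, Measure.restrict_restrict hB,
    inter_eq_self_of_subset_left hBΩ]

variable {j γ : ℝ} (hj : 0 ≤ j) (hγ : 0 < γ)

/-- The superposition operator of `dualMap j γ`. -/
def dualOp (u : L2Field Ω) : L2Field Ω :=
  (lipschitzWith_dualMap hj hγ).compLp (dualMap_zero j γ) u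

theorem coeFn_dualOp (u : L2Field Ω) :
    dualOp hj hγ u =ᵐ[volume.restrict Ω] fun x => dualMap j γ (u x) :=
  LipschitzWith.coeFn_compLp _ _ u

theorem inner_cutoff_dualOp_sub_nonneg {ω : Set E3} (hω : MeasurableSet ω) (u v : L2Field Ω) :
    0 ≤ inner ℝ (cutoff hω (dualOp hj hγ u) - cutoff hω (dualOp hj hγ v)) (u - v) := by
  rw [L2.inner_def]
  refine integral_nonneg_of_ae ?_
  filter_upwards [coeFn_cutoff hω (dualOp hj hγ u), coeFn_cutoff hω (dualOp hj hγ v),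
    coeFn_dualOp hj hγ u, coeFn_dualOp hj hγ v, Lp.coeFn_sub u v,
    Lp.coeFn_sub (cutoff hω (dualOp hj hγ u)) (cutoff hω (dualOp hj hγ v))]
    with x h1 h2 h3 h4 h5 h6
  rw [h5, h6, Pi.sub_apply, Pi.sub_apply, h1, h2]
  by_cases hx : x ∈ ω
  · simp only [hx, indicator_of_mem, h3, h4]
    exact inner_dualMap_sub_nonneg hj hγ _ _
  · simp [hx]

theorem inner_cutoff_dualOp {ω : Set E3} (hω : MeasurableSet ω) (hωΩ : ω ⊆ Ω)
    (u v : L2Field Ω) :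
    inner ℝ (cutoff hω (dualOp hj hγ u)) v = ∫ x in ω, inner ℝ (dualMap j γ (u x)) (v x) := by
  rw [inner_cutoff hω hωΩ]
  refine integral_congr_ae ?_
  filter_upwards [ae_restrict_of_ae_restrict_of_subset hωΩ (coeFn_dualOp hj hγ u)] with x hx
  rw [hx]

end operators

namespace HTSData

variable {D : HTSData}

/-! ### The penalized state equation -/

/-- The bounded operator on `H₀(curl)` represented by the bilinear form. -/
def bilinOp (hD : D.Admissible) : H0curl D.Ω →L[ℝ] H0curl D.Ω :=
  (fieldL D.Ω).adjoint ∘L mulOp hD.material_ε.memLp_toEuclideanCLM ∘L fieldL D.Ω +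
    (rotL D.Ω).adjoint ∘L mulOp hD.material_ν.memLp_toEuclideanCLM ∘L rotL D.Ω

theorem inner_bilinOp (hD : D.Admissible) (v w : H0curl D.Ω) :
    inner ℝ (bilinOp hD v) w
      = inner ℝ (mulOp hD.material_ε.memLp_toEuclideanCLM (fieldL D.Ω v)) (fieldL D.Ω w)
        + inner ℝ (mulOp hD.material_ν.memLp_toEuclideanCLM (rotL D.Ω v)) (rotL D.Ω w) := by
  simp only [bilinOp, add_apply, ContinuousLinearMap.comp_apply,
    inner_add_left, ContinuousLinearMap.adjoint_inner_left]

theorem inner_bilinOp_eq_bilin (hD : D.Admissible) (v w : H0curl D.Ω) :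
    inner ℝ (bilinOp hD v) w = D.bilin v w := by
  rw [inner_bilinOp, inner_mulOp, inner_mulOp, add_comm]
  simp only [inner_toEuclideanCLM]
  rfl

theorem exists_mul_norm_sq_le_inner_bilinOp (hD : D.Admissible) :
    ∃ c > 0, ∀ v, c * ‖v‖ ^ 2 ≤ inner ℝ (bilinOp hD v) v := by
  obtain ⟨a, ha, h⟩ := hD.material_ε.exists_mul_norm_sq_le
  obtain ⟨b, hb, h'⟩ := hD.material_ν.exists_mul_norm_sq_le
  refine ⟨min a b, lt_min ha hb, fun v => ?_⟩
  rw [inner_bilinOp, norm_sq_H0curl, mul_add]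
  refine add_le_add (le_trans ?_ (h _)) (le_trans ?_ (h' _))
  · gcongr
    exact min_le_left a b
  · gcongr
    exact min_le_right a b

section stateOp

variable (hD : D.Admissible) {γ : ℝ} (hγ : 0 < γ) {ω : Set E3} (hω : MeasurableSet ω)

/-- The operator of the penalized state equation. -/
def stateOp (E : H0curl D.Ω) : H0curl D.Ω :=
  bilinOp hD E + (fieldL D.Ω).adjoint (cutoff hω (dualOp hD.jc_pos.le hγ (fieldL D.Ω E)))

theorem inner_stateOp (hωΩ : ω ⊆ D.Ω) (E v : H0curl D.Ω) :
    inner ℝ (stateOp hD hγ hω E) v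
      = D.bilin E v + ∫ x in ω, inner ℝ (dualMap D.jc γ (field E x)) (field v x) := by
  rw [stateOp, inner_add_left, inner_bilinOp_eq_bilin, ContinuousLinearMap.adjoint_inner_left,
    inner_cutoff_dualOp _ _ _ hωΩ]
  rfl

/-- The load of the state equation as an element of `H₀(curl)`. -/
def load : H0curl D.Ω :=
  (fieldL D.Ω).adjoint (hD.memLp_f.toLp D.f)

theorem inner_load (v : H0curl D.Ω) :
    inner ℝ (load hD) v = ∫ x in D.Ω, inner ℝ (D.f x) (field v x) := by
  rw [load, ContinuousLinearMap.adjoint_inner_left, real_inner_comm,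
    ← integral_inner_eq_inner_toLp]
  exact integral_congr_ae (Eventually.of_forall fun x => real_inner_comm _ _)

theorem isState_iff (hωΩ : ω ⊆ D.Ω) (E : H0curl D.Ω) :
    D.IsState γ ω E ↔ stateOp hD hγ hω E = load hD := by
  simp only [IsState, ← inner_stateOp hD hγ hω hωΩ, ← inner_load hD]
  exact ⟨fun h => ext_inner_right ℝ h, fun h v => by rw [h]⟩

theorem exists_lipschitzWith_stateOp : ∃ K, LipschitzWith K (stateOp hD hγ hω) :=
  ⟨_, (bilinOp hD).lipschitz.add
    ((((fieldL D.Ω).adjoint ∘L cutoff hω).lipschitz.comp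
      (LipschitzWith.lipschitzWith_compLp (lipschitzWith_dualMap hD.jc_pos.le hγ)
        (dualMap_zero D.jc γ))).comp (fieldL D.Ω).lipschitz)⟩

/-- The constant is the coercivity constant of the bilinear form, chosen before `ω`, since the
monotone shape-dependent term only helps. This uniformity drives the continuity in the shape. -/
theorem exists_stronglyMonotone_stateOp :
    ∃ c > 0, ∀ {ω : Set E3} (hω : MeasurableSet ω) (u v : H0curl D.Ω),
      c * ‖u - v‖ ^ 2 ≤ inner ℝ (stateOp hD hγ hω u - stateOp hD hγ hω v) (u - v) := by
  obtain ⟨c, hc, h⟩ := exists_mul_norm_sq_le_inner_bilinOp hD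
  refine ⟨c, hc, fun {ω} hω u v => ?_⟩
  rw [stateOp, stateOp, add_sub_add_comm, inner_add_left, ← map_sub, ← map_sub,
    ContinuousLinearMap.adjoint_inner_left, map_sub (fieldL D.Ω)]
  exact le_add_of_le_of_nonneg (h _) (inner_cutoff_dualOp_sub_nonneg _ _ _ _ _)

end stateOp

theorem existsUnique_isState (hD : D.Admissible) {γ : ℝ} (hγ : 0 < γ) {ω : Set E3}
    (hω : MeasurableSet ω) (hωΩ : ω ⊆ D.Ω) : ∃! E : H0curl D.Ω, D.IsState γ ω E := by
  obtain ⟨K, hK⟩ := exists_lipschitzWith_stateOp hD hγ hω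
  obtain ⟨c, hc, hmono⟩ := exists_stronglyMonotone_stateOp hD hγ
  simp only [isState_iff hD hγ hω hωΩ]
  exact existsUnique_of_stronglyMonotone hK hc (hmono hω) _

theorem stateOp_state (hD : D.Admissible) {γ : ℝ} (hγ : 0 < γ) {ω : Set E3}
    (hω : MeasurableSet ω) (hωΩ : ω ⊆ D.Ω) : stateOp hD hγ hω (D.state γ ω) = load hD :=
  (isState_iff hD hγ hω hωΩ _).1
    (Classical.epsilon_spec (existsUnique_isState hD hγ hω hωΩ).exists)

/-- By the stability estimate, the distance of the states is controlled by the two operators'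
difference at the limit state `E`. There the dual variable `g` is one fixed field bounded by `jc`,
cut off to two different sets. -/
theorem tendsto_state (hD : D.Admissible) {γ : ℝ} (hγ : 0 < γ) {ι : Type*} {l : Filter ι}
    {ω : ι → Set E3} {ω' : Set E3} (hω : ∀ n, MeasurableSet (ω n)) (hω' : MeasurableSet ω')
    (hsub : ∀ n, ω n ⊆ D.Ω) (hsub' : ω' ⊆ D.Ω)
    (hlim : Tendsto (fun n => volume (symmDiff (ω n) ω')) l (𝓝 0)) :
    Tendsto (fun n => D.state γ (ω n)) l (𝓝 (D.state γ ω')) := by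
  obtain ⟨c, hc, hmono⟩ := exists_stronglyMonotone_stateOp hD hγ
  set E := D.state γ ω'
  set g := dualOp hD.jc_pos.le hγ (fieldL D.Ω E)
  have hg : ∀ᵐ x ∂volume.restrict D.Ω, ‖g x‖ ≤ D.jc := by
    filter_upwards [coeFn_dualOp hD.jc_pos.le hγ (fieldL D.Ω E)] with x hx
    rw [hx]
    exact norm_dualMap_le hD.jc_pos.le hγ _
  have hcut : Tendsto (fun n => cutoff hω' g - cutoff (hω n) g) l (𝓝 0) := by
    rw [tendsto_zero_iff_enorm_tendsto_zero]
    have hpow : Tendsto (fun n => ‖D.jc‖ₑ * volume (symmDiff ω' (ω n)) ^ (1 / 2 : ℝ)) l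
        (𝓝 (‖D.jc‖ₑ * 0 ^ (1 / 2 : ℝ))) := by
      refine ENNReal.Tendsto.const_mul ?_ (Or.inr enorm_ne_top)
      simp only [symmDiff_comm ω']
      exact (ENNReal.continuous_rpow_const.tendsto _).comp hlim
    rw [ENNReal.zero_rpow_of_pos (by norm_num), mul_zero] at hpow
    exact tendsto_of_tendsto_of_tendsto_of_le_of_le tendsto_const_nhds hpow
      (fun _ => zero_le) fun n => enorm_cutoff_sub_cutoff_le hω' (hω n) hg
  have hadj := (((fieldL D.Ω).adjoint.continuous.tendsto 0).comp hcut).norm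
  rw [map_zero, norm_zero] at hadj
  have hdiff : Tendsto (fun n => c⁻¹ * ‖(fieldL D.Ω).adjoint (cutoff hω' g - cutoff (hω n) g)‖) l
      (𝓝 0) := by
    simpa using hadj.const_mul c⁻¹
  rw [tendsto_iff_norm_sub_tendsto_zero]
  refine squeeze_zero (fun _ => norm_nonneg _) (fun n => ?_) hdiff
  have h1 := mul_norm_sub_le_of_stronglyMonotone (hmono (hω n)) (u := D.state γ (ω n)) (u' := E)
    (A' := stateOp hD hγ hω')
    ((stateOp_state hD hγ (hω n) (hsub n)).trans (stateOp_state hD hγ hω' hsub').symm)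
  -- The bilinear parts at `E` cancel; only the cutoffs differ.
  rw [stateOp, stateOp, add_sub_add_left_eq_sub, ← map_sub] at h1
  rwa [le_inv_mul_iff₀ hc]

/-! ### The cost functional -/

theorem Admissible.isOpen_B (hD : D.Admissible) : IsOpen D.B :=
  hD.lipschitz_B.1

theorem Admissible.isBounded_B (hD : D.Admissible) : Bornology.IsBounded D.B :=
  hD.bounded.subset hD.subset

theorem Admissible.memLp_weight (hD : D.Admissible) :
    MemLp (D.B.indicator fun x => D.κ x • ContinuousLinearMap.id ℝ E3) ∞
      (volume.restrict D.Ω) := by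
  refine memLp_indicator_of_subset hD.isOpen_B.measurableSet hD.subset ?_
  exact ((ContinuousLinearMap.id ℝ ℝ).smulRight (ContinuousLinearMap.id ℝ E3)).comp_memLp'
    (hD.isC1_κ.memLp_top hD.isOpen_B)

theorem Admissible.memLp_target (hD : D.Admissible) :
    MemLp (D.B.indicator D.Ed) 2 (volume.restrict D.Ω) := by
  refine memLp_indicator_of_subset hD.isOpen_B.measurableSet hD.subset ?_
  have : IsFiniteMeasure (volume.restrict D.B) :=
    isFiniteMeasure_restrict.2 hD.isBounded_B.measure_lt_top.ne
  exact (hD.isC1_Ed.memLp_top hD.isOpen_B).mono_exponent le_top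

/-- Written as a quadratic form of a bounded operator on square integrable fields, the tracking term
is visibly continuous in `E`. -/
theorem tracking_eq_inner (hD : D.Admissible) (E : H0curl D.Ω) :
    ∫ x in D.B, D.κ x * ‖field E x - D.Ed x‖ ^ 2
      = inner ℝ (mulOp hD.memLp_weight (fieldL D.Ω E - hD.memLp_target.toLp _))
          (fieldL D.Ω E - hD.memLp_target.toLp _) := by
  rw [inner_mulOp]
  have h : (fun x => inner ℝ ((D.B.indicator fun x => D.κ x • ContinuousLinearMap.id ℝ E3) x
      ((fieldL D.Ω E - hD.memLp_target.toLp _ : L2Field D.Ω) x))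
      ((fieldL D.Ω E - hD.memLp_target.toLp _ : L2Field D.Ω) x)) =ᵐ[volume.restrict D.Ω]
      D.B.indicator fun x => D.κ x * ‖field E x - D.Ed x‖ ^ 2 := by
    filter_upwards [Lp.coeFn_sub (fieldL D.Ω E) (hD.memLp_target.toLp _),
      hD.memLp_target.coeFn_toLp] with x h1 h2
    rw [h1, Pi.sub_apply, h2]
    by_cases hx : x ∈ D.B
    · simp only [hx, indicator_of_mem, smul_apply,
        ContinuousLinearMap.id_apply, real_inner_smul_left, real_inner_self_eq_norm_sq]
      rfl
    · simp [hx]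
  rw [integral_congr_ae h, setIntegral_indicator hD.isOpen_B.measurableSet,
    inter_eq_self_of_subset_right hD.subset]

theorem continuous_tracking (hD : D.Admissible) :
    Continuous fun E : H0curl D.Ω => ∫ x in D.B, D.κ x * ‖field E x - D.Ed x‖ ^ 2 := by
  simp only [tracking_eq_inner hD]
  fun_prop

theorem cost_nonneg (hD : D.Admissible) (γ : ℝ) (ω : Set E3) : 0 ≤ D.cost γ ω := by
  have h : 0 ≤ ∫ x in D.B, D.κ x * ‖field (D.state γ ω) x - D.Ed x‖ ^ 2 :=
    setIntegral_nonneg hD.isOpen_B.measurableSet fun x hx =>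
      mul_nonneg (hD.κ_pos x hx).le (sq_nonneg _)
  have h' : 0 ≤ ∫ _x in ω, (1 : ℝ) := integral_nonneg fun _ => zero_le_one
  rw [cost]
  positivity

theorem tendsto_cost (hD : D.Admissible) {γ : ℝ} (hγ : 0 < γ) {ι : Type*} {l : Filter ι}
    {ω : ι → Set E3} {ω' : Set E3} (hω : ∀ n, MeasurableSet (ω n)) (hω' : MeasurableSet ω')
    (hsub : ∀ n, ω n ⊆ D.B) (hsub' : ω' ⊆ D.B)
    (hlim : Tendsto (fun n => volume (symmDiff (ω n) ω')) l (𝓝 0)) :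
    Tendsto (fun n => D.cost γ (ω n)) l (𝓝 (D.cost γ ω')) := by
  have hstate := tendsto_state hD hγ hω hω' (fun n => (hsub n).trans hD.subset)
    (hsub'.trans hD.subset) hlim
  have hfin : ∀ s ⊆ D.B, volume s ≠ ∞ := fun s hs =>
    (hD.isBounded_B.subset hs).measure_lt_top.ne
  have hvol : Tendsto (fun n => ∫ _x in ω n, (1 : ℝ)) l (𝓝 (∫ _x in ω', (1 : ℝ))) := by
    simp only [integral_const, smul_eq_mul, mul_one, measureReal_restrict_apply_univ]
    rw [tendsto_iff_norm_sub_tendsto_zero]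
    refine squeeze_zero (fun _ => norm_nonneg _) (fun n => ?_)
      ((ENNReal.tendsto_toReal ENNReal.zero_ne_top).comp hlim)
    exact abs_measureReal_sub_le_measureReal_symmDiff' (hω n).nullMeasurableSet
      hω'.nullMeasurableSet (hfin _ (hsub n)) (hfin _ hsub')
  exact ((((continuous_tracking hD).tendsto _).comp hstate).const_mul _).add hvol

theorem empty_mem_shapes (L : ℝ≥0) (r : ℝ) : ∅ ∈ D.shapes L r :=
  ⟨empty_subset _, isOpen_empty, fun x hx => by simp at hx⟩

theorem exists_isMinOn_cost (hD : D.Admissible) (L : ℝ≥0) {r : ℝ} (hr : 0 < r) {γ : ℝ}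
    (hγ : 0 < γ) : ∃ ω ∈ D.shapes L r, IsMinOn (D.cost γ) (D.shapes L r) ω := by
  have hbdd : BddBelow (D.cost γ '' D.shapes L r) :=
    ⟨0, forall_mem_image.2 fun ω _ => cost_nonneg hD γ ω⟩
  obtain ⟨u, -, hu, hmem⟩ := exists_seq_tendsto_sInf
    (Set.Nonempty.image (D.cost γ) ⟨∅, empty_mem_shapes L r⟩) hbdd
  choose ω hω hcost using hmem
  -- Any ultrafilter finer than `atTop` will do: the costs of the minimizing sequence still tend to
  -- the infimum along it.
  let 𝒰 : Ultrafilter ℕ := Filter.hyperfilter ℕ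
  have hlim := tendsto_volume_symmDiff_limitShape (𝒰 := 𝒰) hD.isBounded_B hr
    (fun n => (hω n).1) (fun n => (hω n).2.1) fun n => (hω n).2.2
  have hB : limitShape 𝒰 ω ⊆ D.B := limitShape_subset fun n => (hω n).1
  have h1 := tendsto_cost hD hγ (fun n => (hω n).2.1.measurableSet)
    isOpen_limitShape.measurableSet (fun n => (hω n).1) hB hlim
  simp only [hcost] at h1
  have h2 := tendsto_nhds_unique h1 (hu.mono_left Nat.hyperfilter_le_atTop)
  refine ⟨limitShape 𝒰 ω, ⟨hB, isOpen_limitShape, isUniformlyLipschitz_limitShape hr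
    (fun n => (hω n).2.1) fun n => (hω n).2.2⟩, isMinOn_iff.2 fun ω' hω' => ?_⟩
  rw [h2]
  exact csInf_le hbdd (mem_image_of_mem _ hω')

end HTSData

end

theorem theorem3p2 (D : HTSData) (hD : D.Admissible) (L : ℝ≥0) (r : ℝ) (hr : 0 < r)
    (γ : ℝ) (hγ : 0 < γ) :
    (∀ ω ∈ D.shapes L r, ∃! E : H0curl D.Ω, D.IsState γ ω E) ∧
      ∃ ωopt ∈ D.shapes L r, ∀ ω ∈ D.shapes L r, D.cost γ ωopt ≤ D.cost γ ω := by
  refine ⟨fun ω hω => HTSData.existsUnique_isState hD hγ hω.2.1.measurableSet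
    (hω.1.trans hD.subset), ?_⟩
  obtain ⟨ω, hω, hmin⟩ := HTSData.exists_isMinOn_cost hD L hr hγ
  exact ⟨ω, hω, isMinOn_iff.1 hmin⟩
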